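/- Let $N\ge 1$ be an integer and let $\alpha>0$, $0<\gamma<N$, $\gamma<2/\alpha$. For $t>0$ let $e^{t\Delta}f(x)=\int_{\mathbb R^N}(4\pi t)^{-N/2}e^{-|x-y|^2/(4t)}f(y)\,dy$ be the heat semigroup on $\mathbb R^N$. For a locally integrable $u_0\ge 0$ on $\mathbb R^N$, let $T_{\max}(u_0)\in[0,\infty]$ denote the maximal existence time of a nonnegative solution of the nonlinear heat equation $\partial_t u=\Delta u+|u|^\alpha u$, $u(0)=u_0$, that is, the supremum of all $T$ for which there is a measurable function $u:(0,T)\times\mathbb R^N\to[0,\infty)$ with $$u(t)=e^{t\Delta}u_0+\int_0^t e^{(t-\sigma)\Delta}\big[|u(\sigma)|^\alpha u(\sigma)\big]\,d\sigma\quad\text{a.e. on }(0,T)\times\mathbb R^N$$ ($T_{\max}(u_0)=0$ if there is no local nonnegative solution). Let $\omega\in L^\infty(\mathbb R^N)$ be homogeneous of degree $0$ with $\omega\ge 0$ and $\omega\not\equiv 0$, and let $\varphi\in L^1_{\mathrm{loc}}(\mathbb R^N)$, $\varphi\ge 0$, satisfy $\varphi(x)\ge\omega(x)|x|^{-\gamma}$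 for $|x|\ge R$, for some $R>0$. (Relations between functions are understood almost everywhere.) Then $T_{\max}(\lambda\varphi)<\infty$ for all $\lambda>0$, and $$\limsup_{\lambda\to 0^+}\lambda^{\left(\frac1\alpha-\frac\gamma2\right)^{-1}}T_{\max}(\lambda\varphi)\le\frac{1}{\left(\alpha^{1/\alpha}\,\big\|e^{\Delta}(\omega|\cdot|^{-\gamma})\big\|_\infty\right)^{\left(\frac1\alpha-\frac\gamma2\right)^{-1}}}.$$ -/

import Mathlib

open MeasureTheory Filter Topology
open scoped ENNReal

namespace NLH

/-- The Gauss kernel `(4πt)^{-N/2} exp(-|x|²/(4t))` of `ℝ^N`, used for `t > 0`. -/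
noncomputable def gaussKernel {N : ℕ} (t : ℝ) (x : EuclideanSpace ℝ (Fin N)) : ℝ :=
  (4 * Real.pi * t) ^ (-(N : ℝ) / 2) * Real.exp (-‖x‖ ^ 2 / (4 * t))

/-- The heat semigroup `e^{tΔ}` of `ℝ^N` (for `t > 0`) on a nonnegative function `f`. The integral of
a nonnegative function is taken in `[0, ∞]`, so `e^{tΔ} f (x)` is defined for every `x`. -/
noncomputable def heat {N : ℕ} (t : ℝ) (f : EuclideanSpace ℝ (Fin N) → ℝ)
    (x : EuclideanSpace ℝ (Fin N)) : ℝ≥0∞ :=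
  ∫⁻ y, ENNReal.ofReal (gaussKernel t (x - y) * f y)

/-- `u` is a nonnegative solution on `(0, T) × ℝ^N`, `0 ≤ T ≤ ∞`, of the integral equation
`u(t) = e^{tΔ} u₀ + ∫₀ᵗ e^{(t-σ)Δ} [|u(σ)|^α u(σ)] dσ`, for initial data `u₀ ≥ 0`.
The equation is an identity in `[0, ∞]` between a real number on the left and the (possibly infinite)
integrals on the right, so both terms on the right are finite wherever it holds. It is required for
almost every `(t, x) ∈ (0, T) × ℝ^N`, without any regularity beyond measurability. (The values of
`u` outside `(0, T) × ℝ^N` play no role.) -/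
structure IsNonnegSolution {N : ℕ} (α : ℝ) (u₀ : EuclideanSpace ℝ (Fin N) → ℝ) (T : ℝ≥0∞)
    (u : ℝ → EuclideanSpace ℝ (Fin N) → ℝ) : Prop where
  measurable : Measurable (Function.uncurry u)
  nonneg : ∀ t x, 0 ≤ u t x
  integral_eq : ∀ᵐ t : ℝ, 0 < t → ENNReal.ofReal t < T → ∀ᵐ x : EuclideanSpace ℝ (Fin N),
    ENNReal.ofReal (u t x) =
      heat t u₀ x + ∫⁻ σ in Set.Ioo 0 t, heat (t - σ) (fun y => |u σ y| ^ α * u σ y) x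

/-- `T_max(u₀) ∈ [0, ∞]`, the maximal existence time of a nonnegative solution with initial data `u₀`:
the supremum of all `T` such that a nonnegative solution exists on `(0, T)`; it is `0` if there is no
local nonnegative solution. -/
noncomputable def Tmax {N : ℕ} (α : ℝ) (u₀ : EuclideanSpace ℝ (Fin N) → ℝ) : ℝ≥0∞ :=
  sSup {T : ℝ≥0∞ | ∃ u, IsNonnegSolution α u₀ T u}

/-- `‖e^{tΔ} f‖_∞ ∈ [0, ∞]` for a nonnegative function `f`. -/
noncomputable def heatSupNorm {N : ℕ} (t : ℝ) (f : EuclideanSpace ℝ (Fin N) → ℝ) : ℝ≥0∞ :=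
  essSup (heat t f) volume

end NLH

namespace NLH

variable {N : ℕ}

/-! Fix `t` and `x`, and follow `g(s) = e^{(t-s)Δ}u(s)(x)` for `0 < s < t`. By the semigroup law,
the integral equation becomes `g(s) = e^{tΔ}u₀(x) + ∫₀ˢ e^{(t-σ)Δ}[u(σ)^{1+α}](x) dσ`, and Jensen's
inequality bounds the integrand below by `g(σ)^{1+α}`. So `g` dominates the solution of `y' =
y^{1+α}` starting at `e^{tΔ}u₀(x)`, and finiteness up to time `t` forces `α t (e^{tΔ}u₀(x))^α ≤ 1`
(`IsNonnegSolution.ofReal_mul_heat_rpow_le_one`).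

For `u₀ = λφ`, rescale space by `√t`. If `√t ≥ R/ε`, homogeneity gives `φ(√t y) ≥ t^{-γ/2} ψ_ε(y)`,
where `ψ_ε` is the profile cut off inside radius `ε`. Hence, with `κ = 1/α - γ/2`, either `t ≤
(R/ε)²` or `λ t^κ α^{1/α} ‖e^Δ ψ_ε‖_∞ ≤ 1` (`ofReal_mul_Tmax_le`). After multiplication by `λ^{1/κ}`
the first alternative vanishes as `λ → 0`. Letting `ε → 0` by monotone convergence gives the stated
constant. -/

/-! ### Blow-up for a superlinear integral inequality. -/

theorem mul_rpow_le_one_of_superlinear {α t A : ℝ} (hα : 0 < α) (ht : 0 < t) (hA : 0 < A)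
    {g : ℝ → ℝ} (hg : Continuous g) (hg0 : ∀ s ∈ Set.Icc 0 t, 0 ≤ g s)
    (h : ∀ s ∈ Set.Icc 0 t, A + ∫ σ in 0..s, g σ ^ (1 + α) ≤ g s) :
    α * t * A ^ α ≤ 1 := by
  have hc : Continuous fun s => g s ^ (1 + α) :=
    hg.rpow_const fun _ => Or.inr (by linarith)
  set y : ℝ → ℝ := fun s => A + ∫ σ in 0..s, g σ ^ (1 + α) with hy
  have hd : ∀ s, HasDerivAt y (g s ^ (1 + α)) s := fun s =>
    ((hc.integral_hasStrictDerivAt 0 s).hasDerivAt).const_add A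
  have hyA : ∀ s ∈ Set.Icc 0 t, A ≤ y s := by
    intro s hs
    have : 0 ≤ ∫ σ in 0..s, g σ ^ (1 + α) :=
      intervalIntegral.integral_nonneg hs.1 fun u hu =>
        Real.rpow_nonneg (hg0 u ⟨hu.1, hu.2.trans hs.2⟩) _
    simp only [hy]; linarith
  -- `y^{-α} + α s` is constant along `y' = y^{1+α}`; here `y' = g^{1+α} ≥ y^{1+α}`, so it is
  -- nonincreasing.
  have hd' : ∀ s ∈ Set.Icc 0 t, HasDerivAt (fun s => y s ^ (-α) + α * s)
      (g s ^ (1 + α) * (-α) * y s ^ (-α - 1) + α) s := by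
    intro s hs
    have h1 := (hd s).rpow_const (p := -α) (Or.inl (hA.trans_le (hyA s hs)).ne')
    have h2 : HasDerivAt (fun s : ℝ => α * s) α s := by
      simpa using (hasDerivAt_id s).const_mul α
    exact h1.add h2
  have hanti : AntitoneOn (fun s => y s ^ (-α) + α * s) (Set.Icc 0 t) := by
    apply antitoneOn_of_deriv_nonpos (convex_Icc 0 t)
    · exact fun s hs => (hd' s hs).continuousAt.continuousWithinAt
    · exact fun s hs => (hd' s (interior_subset hs)).differentiableAt.differentiableWithinAt
    · intro s hs
      have hs := interior_subset hs
      rw [(hd' s hs).deriv]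
      have hy0 := hA.trans_le (hyA s hs)
      have h1 : y s ^ (1 + α) ≤ g s ^ (1 + α) :=
        Real.rpow_le_rpow hy0.le (h s hs) (by linarith)
      have h2 : y s ^ (1 + α) * y s ^ (-α - 1) = 1 := by
        rw [← Real.rpow_add hy0, show 1 + α + (-α - 1) = 0 by ring, Real.rpow_zero]
      have h3 : 0 < y s ^ (-α - 1) := Real.rpow_pos_of_pos hy0 _
      nlinarith [mul_le_mul_of_nonneg_right h1 h3.le]
  have h1 := hanti (Set.left_mem_Icc.2 ht.le) (Set.right_mem_Icc.2 ht.le) ht.le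
  have h2 : 0 ≤ y t ^ (-α) :=
    Real.rpow_nonneg (hA.le.trans (hyA t (Set.right_mem_Icc.2 ht.le))) _
  simp only [hy, intervalIntegral.integral_same, add_zero, mul_zero] at h1 h2
  have h3 : α * t ≤ A ^ (-α) := by linarith
  calc α * t * A ^ α ≤ A ^ (-α) * A ^ α :=
        mul_le_mul_of_nonneg_right h3 (Real.rpow_nonneg hA.le _)
    _ = 1 := by rw [← Real.rpow_add hA]; simp

/-- Transfers the blow-up bound to a merely measurable integrand with an almost everywhere
inequality: the primitive `A + ∫ h` is continuous and takes the role of `g`. -/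
theorem ofReal_mul_rpow_le_one_of_superlinear {α t : ℝ} (hα : 0 < α) (ht : 0 < t) {A : ℝ≥0∞}
    {h : ℝ → ℝ≥0∞} (hm : Measurable h) (hfin : A + ∫⁻ σ in Set.Ioo 0 t, h σ ≠ ∞)
    (hle : ∀ᵐ s : ℝ, s ∈ Set.Ioo 0 t → (A + ∫⁻ σ in Set.Ioo 0 s, h σ) ^ (1 + α) ≤ h s) :
    ENNReal.ofReal (α * t) * A ^ α ≤ 1 := by
  obtain ⟨hAf, hhf⟩ := ENNReal.add_ne_top.1 hfin
  rcases eq_or_ne A 0 with rfl | hA0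
  · simp [hα]
  have hAp : 0 < A.toReal := ENNReal.toReal_pos hA0 hAf
  -- Extension by zero makes the primitive continuous on all of `ℝ`.
  set H : ℝ → ℝ := (Set.Ioo 0 t).indicator fun σ => (h σ).toReal with hH
  have hI : IntegrableOn (fun σ => (h σ).toReal) (Set.Ioo 0 t) :=
    integrable_toReal_of_lintegral_ne_top hm.aemeasurable hhf
  have hHint : Integrable H := (integrable_indicator_iff measurableSet_Ioo).2 hI
  have hH0 : ∀ s, 0 ≤ H s := fun s => Set.indicator_nonneg (fun _ _ => ENNReal.toReal_nonneg) _
  have hlt : ∀ᵐ σ : ℝ, σ ∈ Set.Ioo 0 t → h σ < ∞ :=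
    (ae_restrict_iff' measurableSet_Ioo).1 (ae_lt_top hm hhf)
  set g : ℝ → ℝ := fun s => A.toReal + ∫ σ in 0..s, H σ with hgdef
  have hgc : Continuous g :=
    continuous_const.add (intervalIntegral.continuous_primitive
      (fun a b => hHint.intervalIntegrable) 0)
  have hg : ∀ s ∈ Set.Icc 0 t, g s = (A + ∫⁻ σ in Set.Ioo 0 s, h σ).toReal := by
    intro s hs
    have hsub : Set.Ioo 0 s ⊆ Set.Ioo 0 t := Set.Ioo_subset_Ioo_right hs.2
    have hsf : ∫⁻ σ in Set.Ioo 0 s, h σ ≠ ∞ := ne_top_of_le_ne_top hhf (lintegral_mono_set hsub)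
    rw [ENNReal.toReal_add hAf hsf]
    simp only [hgdef]
    rw [intervalIntegral.integral_of_le hs.1, integral_Ioc_eq_integral_Ioo,
      ← integral_toReal hm.aemeasurable (ae_lt_top hm hsf)]
    congr 1
    exact setIntegral_congr_fun measurableSet_Ioo fun x hx => by
      simp [hH, Set.indicator_of_mem (hsub hx)]
  have key := mul_rpow_le_one_of_superlinear (g := g) hα ht hAp hgc
    (fun s hs => by rw [hg s hs]; exact ENNReal.toReal_nonneg) ?_
  · rw [← ENNReal.ofReal_toReal hAf, ENNReal.ofReal_rpow_of_pos hAp,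
      ← ENNReal.ofReal_mul (by positivity)]
    exact ENNReal.ofReal_le_one.2 key
  · intro s hs
    simp only [hgdef]
    gcongr
    apply intervalIntegral.integral_mono_ae_restrict hs.1
    · exact (hgc.rpow_const fun _ => Or.inr (by linarith)).intervalIntegrable _ _
    · exact hHint.intervalIntegrable
    · rw [Filter.EventuallyLE, ae_restrict_iff' measurableSet_Icc]
      have hne : ∀ᵐ σ : ℝ, σ ≠ 0 ∧ σ ≠ t := by
        filter_upwards [Measure.ae_ne volume 0, Measure.ae_ne volume t] with σ h1 h2
        exact ⟨h1, h2⟩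
      filter_upwards [hle, hlt, hne] with σ h1 h2 h3 h4
      have hσ : σ ∈ Set.Ioo 0 t :=
        ⟨lt_of_le_of_ne h4.1 h3.1.symm, lt_of_le_of_ne (h4.2.trans hs.2) h3.2⟩
      change g σ ^ (1 + α) ≤ H σ
      rw [hg σ ⟨hσ.1.le, hσ.2.le⟩, ENNReal.toReal_rpow]
      simp only [hH, Set.indicator_of_mem hσ]
      exact ENNReal.toReal_mono (h2 hσ).ne (h1 hσ)

/-! ### The Gauss kernel: unit mass and convolution law. -/

theorem gaussKernel_nonneg {t : ℝ} (ht : 0 < t) (x : EuclideanSpace ℝ (Fin N)) :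
    0 ≤ gaussKernel t x := by
  unfold gaussKernel; positivity

theorem gaussKernel_pos {t : ℝ} (ht : 0 < t) (x : EuclideanSpace ℝ (Fin N)) :
    0 < gaussKernel t x := by
  unfold gaussKernel; positivity

theorem measurable_gaussKernel :
    Measurable fun p : ℝ × EuclideanSpace ℝ (Fin N) => gaussKernel p.1 p.2 := by
  unfold gaussKernel; fun_prop

theorem lintegral_exp_neg_mul_sq_sub {b : ℝ} (hb : 0 < b) (c : EuclideanSpace ℝ (Fin N)) :
    ∫⁻ z, ENNReal.ofReal (Real.exp (-b * ‖z - c‖ ^ 2)) =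
      ENNReal.ofReal ((Real.pi / b) ^ ((N : ℝ) / 2)) := by
  rw [lintegral_sub_right_eq_self
    (fun z : EuclideanSpace ℝ (Fin N) => ENNReal.ofReal (Real.exp (-b * ‖z‖ ^ 2))) c]
  have h := GaussianFourier.integral_rexp_neg_mul_sq_norm
    (V := EuclideanSpace ℝ (Fin N)) hb
  rw [← ofReal_integral_eq_lintegral_ofReal, h]
  · simp
  -- A non-integrable function has Bochner integral `0`, whereas the Gaussian integral is positive.
  · by_contra hI
    rw [integral_undef hI] at h
    have : 0 < (Real.pi / b) ^ ((Module.finrank ℝ (EuclideanSpace ℝ (Fin N)) : ℝ) / 2) := by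
      positivity
    exact this.ne h
  · exact .of_forall fun _ => (Real.exp_pos _).le

theorem lintegral_gaussKernel {t : ℝ} (ht : 0 < t) (x : EuclideanSpace ℝ (Fin N)) :
    ∫⁻ y, ENNReal.ofReal (gaussKernel t (x - y)) = 1 := by
  have h : ∀ y : EuclideanSpace ℝ (Fin N), ENNReal.ofReal (gaussKernel t (x - y)) =
      ENNReal.ofReal ((4 * Real.pi * t) ^ (-(N : ℝ) / 2)) *
        ENNReal.ofReal (Real.exp (-(1 / (4 * t)) * ‖y - x‖ ^ 2)) := by
    intro y
    rw [← ENNReal.ofReal_mul (by positivity), gaussKernel, norm_sub_rev]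
    congr 3; ring
  simp_rw [h]
  rw [lintegral_const_mul' _ _ ENNReal.ofReal_ne_top,
    lintegral_exp_neg_mul_sq_sub (by positivity) x, ← ENNReal.ofReal_mul (by positivity),
    show Real.pi / (1 / (4 * t)) = 4 * Real.pi * t by field_simp,
    ← Real.rpow_add (by positivity)]
  simp [neg_div]

/-- Completing the square in `z`: this isolates the `z`-dependence of a product of two Gaussians in
one centred Gaussian. -/
theorem sq_norm_sub_add_sq_norm_sub {E : Type*} [NormedAddCommGroup E] [InnerProductSpace ℝ E]
    {a b : ℝ} (ha : 0 < a) (hb : 0 < b) (x y z : E) :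
    ‖x - z‖ ^ 2 / a + ‖z - y‖ ^ 2 / b = ‖x - y‖ ^ 2 / (a + b) +
      (a + b) / (a * b) * ‖z - ((b / (a + b)) • x + (a / (a + b)) • y)‖ ^ 2 := by
  have h : ∀ v : E, ‖v‖ ^ 2 = inner ℝ v v := fun v => (real_inner_self_eq_norm_sq v).symm
  simp only [h, inner_sub_left, inner_sub_right, inner_add_left, inner_add_right,
    real_inner_smul_left, real_inner_smul_right]
  rw [real_inner_comm x z, real_inner_comm y z, real_inner_comm y x]
  field_simp
  ring

theorem lintegral_gaussKernel_mul_gaussKernel {a b : ℝ} (ha : 0 < a) (hb : 0 < b)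
    (x y : EuclideanSpace ℝ (Fin N)) :
    ∫⁻ z, ENNReal.ofReal (gaussKernel a (x - z)) * ENNReal.ofReal (gaussKernel b (z - y)) =
      ENNReal.ofReal (gaussKernel (a + b) (x - y)) := by
  set c := (b / (a + b)) • x + (a / (a + b)) • y with hc
  set C : ℝ := (4 * Real.pi * a) ^ (-(N : ℝ) / 2) * (4 * Real.pi * b) ^ (-(N : ℝ) / 2) *
    Real.exp (-‖x - y‖ ^ 2 / (4 * (a + b))) with hC
  have hC0 : 0 ≤ C := by positivity
  have h : ∀ z, ENNReal.ofReal (gaussKernel a (x - z)) * ENNReal.ofReal (gaussKernel b (z - y)) =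
      ENNReal.ofReal C *
        ENNReal.ofReal (Real.exp (-((a + b) / (4 * a * b)) * ‖z - c‖ ^ 2)) := by
    intro z
    rw [← ENNReal.ofReal_mul (gaussKernel_nonneg ha _), ← ENNReal.ofReal_mul hC0]
    congr 1
    have he : Real.exp (-‖x - z‖ ^ 2 / (4 * a)) * Real.exp (-‖z - y‖ ^ 2 / (4 * b)) =
        Real.exp (-‖x - y‖ ^ 2 / (4 * (a + b))) *
          Real.exp (-((a + b) / (4 * a * b)) * ‖z - c‖ ^ 2) := by
      rw [← Real.exp_add, ← Real.exp_add]
      congr 1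
      have := sq_norm_sub_add_sq_norm_sub ha hb x y z
      rw [← hc] at this
      have e : ∀ p q : ℝ, -p / (4 * q) = -(p / q) / 4 := fun p q => by
        rw [neg_div, neg_div, div_div, mul_comm]
      rw [e, e, e, show -((a + b) / (4 * a * b)) * ‖z - c‖ ^ 2
        = -((a + b) / (a * b) * ‖z - c‖ ^ 2) / 4 by field_simp]
      linarith
    simp only [gaussKernel, hC]
    rw [mul_mul_mul_comm, he]
    ring
  simp_rw [h]
  rw [lintegral_const_mul' _ _ ENNReal.ofReal_ne_top,
    lintegral_exp_neg_mul_sq_sub (by positivity), ← ENNReal.ofReal_mul hC0]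
  congr 1
  have hp : (4 * Real.pi * a) ^ (-(N : ℝ) / 2) * (4 * Real.pi * b) ^ (-(N : ℝ) / 2) *
      (Real.pi / ((a + b) / (4 * a * b))) ^ ((N : ℝ) / 2) =
        (4 * Real.pi * (a + b)) ^ (-(N : ℝ) / 2) := by
    rw [neg_div, Real.rpow_neg (by positivity), Real.rpow_neg (by positivity),
      Real.rpow_neg (by positivity), ← Real.inv_rpow (by positivity),
      ← Real.inv_rpow (by positivity), ← Real.inv_rpow (by positivity),
      ← Real.mul_rpow (by positivity) (by positivity),
      ← Real.mul_rpow (by positivity) (by positivity)]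
    congr 1
    field_simp
  rw [hC, gaussKernel, ← hp]
  ring

/-! ### The heat semigroup: measurability, semigroup law, Jensen. -/

theorem heat_eq {t : ℝ} (ht : 0 < t) (f : EuclideanSpace ℝ (Fin N) → ℝ)
    (x : EuclideanSpace ℝ (Fin N)) :
    heat t f x = ∫⁻ y, ENNReal.ofReal (gaussKernel t (x - y)) * ENNReal.ofReal (f y) := by
  simp only [heat, ENNReal.ofReal_mul (gaussKernel_nonneg ht _)]

theorem measurable_ofReal_gaussKernel_sub (t : ℝ) (x : EuclideanSpace ℝ (Fin N)) :
    Measurable fun y => ENNReal.ofReal (gaussKernel t (x - y)) :=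
  (measurable_gaussKernel.comp
    (measurable_const.prodMk (measurable_const.sub measurable_id))).ennreal_ofReal

theorem measurable_heat (t : ℝ) {f : EuclideanSpace ℝ (Fin N) → ℝ} (hf : Measurable f) :
    Measurable (heat t f) := by
  unfold heat
  refine Measurable.lintegral_prod_right' (f := fun p : EuclideanSpace ℝ (Fin N) ×
    EuclideanSpace ℝ (Fin N) => ENNReal.ofReal (gaussKernel t (p.1 - p.2) * f p.2)) ?_
  exact ((measurable_gaussKernel.comp (measurable_const.prodMk
    (measurable_fst.sub measurable_snd))).mul (hf.comp measurable_snd)).ennreal_ofReal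

/-- Joint measurability of the Duhamel integrand. -/
theorem measurable_heat_uncurry (t : ℝ) {F : ℝ → EuclideanSpace ℝ (Fin N) → ℝ}
    (hF : Measurable (Function.uncurry F)) :
    Measurable fun p : ℝ × EuclideanSpace ℝ (Fin N) => heat (t - p.1) (F p.1) p.2 := by
  unfold heat
  refine Measurable.lintegral_prod_right' (f := fun q : (ℝ × EuclideanSpace ℝ (Fin N)) ×
    EuclideanSpace ℝ (Fin N) => ENNReal.ofReal
      (gaussKernel (t - q.1.1) (q.1.2 - q.2) * F q.1.1 q.2)) ?_
  have h1 : Measurable fun q : (ℝ × EuclideanSpace ℝ (Fin N)) × EuclideanSpace ℝ (Fin N) =>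
      (t - q.1.1, q.1.2 - q.2) := by fun_prop
  have h2 : Measurable fun q : (ℝ × EuclideanSpace ℝ (Fin N)) × EuclideanSpace ℝ (Fin N) =>
      (q.1.1, q.2) := by fun_prop
  exact ((measurable_gaussKernel.comp h1).mul (hF.comp h2)).ennreal_ofReal

theorem heat_congr_ae {t : ℝ} {f g : EuclideanSpace ℝ (Fin N) → ℝ} (h : f =ᵐ[volume] g) :
    heat t f = heat t g := by
  funext x
  exact lintegral_congr_ae (h.mono fun y hy => by simp only [hy])

/-- The semigroup property of the heat flow. -/
theorem lintegral_gaussKernel_mul_heat {a b : ℝ} (ha : 0 < a) (hb : 0 < b)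
    {f : EuclideanSpace ℝ (Fin N) → ℝ} (hf : Measurable f) (x : EuclideanSpace ℝ (Fin N)) :
    ∫⁻ z, ENNReal.ofReal (gaussKernel a (x - z)) * heat b f z = heat (a + b) f x := by
  have hm : Measurable fun p : EuclideanSpace ℝ (Fin N) × EuclideanSpace ℝ (Fin N) =>
      ENNReal.ofReal (gaussKernel a (x - p.1)) *
        (ENNReal.ofReal (gaussKernel b (p.1 - p.2)) * ENNReal.ofReal (f p.2)) :=
    ((measurable_ofReal_gaussKernel_sub a x).comp measurable_fst).mul
      (((measurable_gaussKernel.comp (measurable_const.prodMk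
        (measurable_fst.sub measurable_snd))).ennreal_ofReal).mul
          (hf.comp measurable_snd).ennreal_ofReal)
  calc _ = ∫⁻ z, ∫⁻ y, ENNReal.ofReal (gaussKernel a (x - z)) *
        (ENNReal.ofReal (gaussKernel b (z - y)) * ENNReal.ofReal (f y)) := by
        refine lintegral_congr fun z => ?_
        rw [heat_eq hb, lintegral_const_mul' _ _ ENNReal.ofReal_ne_top]
    _ = ∫⁻ y, ∫⁻ z, ENNReal.ofReal (gaussKernel a (x - z)) *
        (ENNReal.ofReal (gaussKernel b (z - y)) * ENNReal.ofReal (f y)) :=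
        lintegral_lintegral_swap hm.aemeasurable
    _ = _ := by
        rw [heat_eq (add_pos ha hb)]
        refine lintegral_congr fun y => ?_
        simp_rw [← mul_assoc]
        rw [lintegral_mul_const' _ _ ENNReal.ofReal_ne_top,
          lintegral_gaussKernel_mul_gaussKernel ha hb]

/-- Jensen's inequality for the heat semigroup. -/
theorem heat_rpow_le {t : ℝ} (ht : 0 < t) {α : ℝ} (hα : 0 < α)
    {f : EuclideanSpace ℝ (Fin N) → ℝ} (hf : Measurable f) (hf0 : ∀ y, 0 ≤ f y)
    (x : EuclideanSpace ℝ (Fin N)) :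
    heat t f x ^ (1 + α) ≤ heat t (fun y => |f y| ^ α * f y) x := by
  set G : EuclideanSpace ℝ (Fin N) → ℝ≥0∞ := fun y => ENNReal.ofReal (gaussKernel t (x - y))
  have hG : Measurable G := measurable_ofReal_gaussKernel_sub t x
  set μ := (volume : Measure (EuclideanSpace ℝ (Fin N))).withDensity G
  have hμ : μ Set.univ = 1 := by
    rw [withDensity_apply _ MeasurableSet.univ, setLIntegral_univ]
    exact lintegral_gaussKernel ht x
  -- Jensen is obtained as Hölder against the constant `1` for the probability measure `μ` with
  -- Gaussian density.
  have hp : (1 + α).HolderConjugate ((1 + α).conjExponent) :=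
    Real.HolderConjugate.conjExponent (by linarith)
  have h := ENNReal.lintegral_mul_le_Lp_mul_Lq μ hp
    (hf.ennreal_ofReal.aemeasurable) (aemeasurable_const (b := (1 : ℝ≥0∞)))
  simp only [Pi.mul_apply, mul_one, ENNReal.one_rpow, lintegral_const, hμ] at h
  rw [lintegral_withDensity_eq_lintegral_mul _ hG hf.ennreal_ofReal,
    lintegral_withDensity_eq_lintegral_mul _ hG (hf.ennreal_ofReal.pow_const _)] at h
  simp only [Pi.mul_apply] at h
  have h2 := ENNReal.rpow_le_rpow h (show 0 ≤ 1 + α by linarith)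
  rw [← ENNReal.rpow_mul, one_div_mul_cancel (by linarith), ENNReal.rpow_one] at h2
  rw [heat_eq ht, heat_eq ht]
  refine h2.trans_eq (lintegral_congr fun y => ?_)
  rw [ENNReal.ofReal_rpow_of_nonneg (hf0 y) (by linarith), abs_of_nonneg (hf0 y)]
  rcases (hf0 y).eq_or_lt with h0 | h0
  · simp [← h0, Real.zero_rpow (show 1 + α ≠ 0 by linarith)]
  · rw [add_comm, Real.rpow_add h0, Real.rpow_one]

/-! ### The necessary condition for existence. -/

/-- The heat flow, run up to time `t`, of a solution of the integral equation at time `s`. -/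
theorem heat_eq_of_integral_eq {t s : ℝ} (hs : 0 < s) (hst : s < t)
    {u₀ v : EuclideanSpace ℝ (Fin N) → ℝ} {F : ℝ → EuclideanSpace ℝ (Fin N) → ℝ}
    (hu₀ : Measurable u₀) (hF : Measurable (Function.uncurry F))
    (h : ∀ᵐ x, ENNReal.ofReal (v x) =
      heat s u₀ x + ∫⁻ σ in Set.Ioo 0 s, heat (s - σ) (F σ) x)
    (x : EuclideanSpace ℝ (Fin N)) :
    heat (t - s) v x = heat t u₀ x + ∫⁻ σ in Set.Ioo 0 s, heat (t - σ) (F σ) x := by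
  have hts : 0 < t - s := sub_pos.2 hst
  have hG := measurable_ofReal_gaussKernel_sub (t - s) x
  have hH := measurable_heat_uncurry s hF
  have hFσ : ∀ σ, Measurable (F σ) := fun σ => hF.comp measurable_prodMk_left
  calc heat (t - s) v x
      = ∫⁻ y, (ENNReal.ofReal (gaussKernel (t - s) (x - y)) * heat s u₀ y +
          ∫⁻ σ in Set.Ioo 0 s, ENNReal.ofReal (gaussKernel (t - s) (x - y)) *
            heat (s - σ) (F σ) y) := by
        rw [heat_eq hts]
        refine lintegral_congr_ae (h.mono fun y hy => ?_)
        simp only [hy]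
        rw [mul_add, lintegral_const_mul' _ _ ENNReal.ofReal_ne_top]
    _ = (∫⁻ y, ENNReal.ofReal (gaussKernel (t - s) (x - y)) * heat s u₀ y) +
          ∫⁻ y, ∫⁻ σ in Set.Ioo 0 s, ENNReal.ofReal (gaussKernel (t - s) (x - y)) *
            heat (s - σ) (F σ) y :=
        lintegral_add_left (hG.mul (measurable_heat s hu₀)) _
    _ = (∫⁻ y, ENNReal.ofReal (gaussKernel (t - s) (x - y)) * heat s u₀ y) +
          ∫⁻ σ in Set.Ioo 0 s, ∫⁻ y, ENNReal.ofReal (gaussKernel (t - s) (x - y)) *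
            heat (s - σ) (F σ) y := by
        congr 1
        refine lintegral_lintegral_swap ?_
        exact ((hG.comp measurable_fst).mul (hH.comp measurable_swap)).aemeasurable
    _ = _ := by
        rw [lintegral_gaussKernel_mul_heat hts hs hu₀, sub_add_cancel]
        congr 1
        refine setLIntegral_congr_fun measurableSet_Ioo fun σ hσ => ?_
        rw [lintegral_gaussKernel_mul_heat hts (sub_pos.2 hσ.2) (hFσ σ)]
        congr 1; ring

theorem measurable_heat_left (t : ℝ) {F : ℝ → EuclideanSpace ℝ (Fin N) → ℝ}
    (hF : Measurable (Function.uncurry F)) (x : EuclideanSpace ℝ (Fin N)) :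
    Measurable fun σ => heat (t - σ) (F σ) x := by
  have h : Measurable fun σ : ℝ => (σ, x) := measurable_id.prodMk measurable_const
  exact Measurable.comp (f := fun σ : ℝ => (σ, x)) (measurable_heat_uncurry t hF) h

/-- Necessary condition for existence: the pointwise bound `(α t)^{1/α} e^{tΔ} u₀ ≤ 1`. -/
theorem IsNonnegSolution.ofReal_mul_heat_rpow_le_one {α : ℝ} (hα : 0 < α)
    {u₀ : EuclideanSpace ℝ (Fin N) → ℝ} (hu₀ : AEMeasurable u₀) {T : ℝ≥0∞}
    {u : ℝ → EuclideanSpace ℝ (Fin N) → ℝ} (hu : IsNonnegSolution α u₀ T u) :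
    ∀ᵐ t : ℝ, 0 < t → ENNReal.ofReal t < T →
      ∀ᵐ x, ENNReal.ofReal (α * t) * heat t u₀ x ^ α ≤ 1 := by
  have hF : Measurable (Function.uncurry fun σ y => |u σ y| ^ α * u σ y) :=
    (hu.measurable.abs.pow_const α).mul hu.measurable
  have hum : ∀ s, Measurable (u s) := fun s => hu.measurable.comp measurable_prodMk_left
  obtain ⟨v₀, hv₀, huv⟩ := hu₀
  have hc : ∀ t, heat t u₀ = heat t v₀ := fun t => heat_congr_ae huv
  have heq := hu.integral_eq
  simp only [hc] at heq ⊢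
  filter_upwards [heq] with t ht ht0 htT
  filter_upwards [ht ht0 htT] with x hx
  refine ofReal_mul_rpow_le_one_of_superlinear
    (h := fun σ => heat (t - σ) (fun y => |u σ y| ^ α * u σ y) x) hα ht0
    (measurable_heat_left t hF x) ?_ ?_
  -- Finiteness comes from the equation itself, whose left side is a real number.
  · rw [← hx]; exact ENNReal.ofReal_ne_top
  · filter_upwards [heq] with s hs hst
    have h := hs hst.1 ((ENNReal.ofReal_le_ofReal hst.2.le).trans_lt htT)
    rw [← heat_eq_of_integral_eq hst.1 hst.2 hv₀ hF h x]
    exact heat_rpow_le (sub_pos.2 hst.2) hα (hum s) (hu.nonneg s) x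

/-! ### Parabolic scaling and the truncated profile. -/

theorem gaussKernel_smul {r : ℝ} (hr : 0 < r) (x : EuclideanSpace ℝ (Fin N)) :
    r ^ N * gaussKernel (r ^ 2) (r • x) = gaussKernel 1 x := by
  unfold gaussKernel
  have h1 : (4 * Real.pi * r ^ 2) ^ (-(N : ℝ) / 2) =
      (4 * Real.pi * 1) ^ (-(N : ℝ) / 2) * (r ^ N)⁻¹ := by
    rw [mul_one, Real.mul_rpow (by positivity) (by positivity), ← Real.rpow_natCast r 2,
      ← Real.rpow_mul hr.le, ← Real.rpow_natCast r N, ← Real.rpow_neg hr.le]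
    congr 2; push_cast; ring
  have h2 : -‖r • x‖ ^ 2 / (4 * r ^ 2) = -‖x‖ ^ 2 / (4 * 1) := by
    rw [norm_smul, Real.norm_of_nonneg hr.le]; field_simp
  rw [h1, h2]
  field_simp

theorem ae_comp_smul {r : ℝ} (hr : r ≠ 0) {p : EuclideanSpace ℝ (Fin N) → Prop}
    (h : ∀ᵐ x, p x) : ∀ᵐ x, p (r • x) :=
  (Measure.quasiMeasurePreserving_smul volume hr).ae h

/-- Parabolic scaling of the heat flow. -/
theorem heat_sq_smul {r : ℝ} (hr : 0 < r) (g : EuclideanSpace ℝ (Fin N) → ℝ)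
    (x : EuclideanSpace ℝ (Fin N)) :
    heat (r ^ 2) g (r • x) = heat 1 (fun y => g (r • y)) x := by
  have hr' := hr.ne'
  set e := (Homeomorph.smulOfNeZero (α := EuclideanSpace ℝ (Fin N)) r hr').toMeasurableEquiv
  set k : EuclideanSpace ℝ (Fin N) → ℝ≥0∞ :=
    fun y => ENNReal.ofReal (gaussKernel (r ^ 2) (r • x - y) * g y)
  have h : ∫⁻ y, k (r • y) = ENNReal.ofReal ((r ^ N)⁻¹) * ∫⁻ y, k y := by
    have h1 : ∫⁻ y, k y ∂(Measure.map (fun y => r • y) volume) = ∫⁻ y, k (r • y) :=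
      lintegral_map_equiv k e
    rw [← h1, Measure.map_addHaar_smul volume hr', lintegral_smul_measure,
      finrank_euclideanSpace_fin, abs_of_pos (by positivity)]
    rfl
  have h2 : heat (r ^ 2) g (r • x) = ENNReal.ofReal (r ^ N) * ∫⁻ y, k (r • y) := by
    rw [h, ← mul_assoc, ← ENNReal.ofReal_mul (by positivity),
      mul_inv_cancel₀ (by positivity), ENNReal.ofReal_one, one_mul]
    rfl
  rw [h2, ← lintegral_const_mul' _ _ ENNReal.ofReal_ne_top]
  refine lintegral_congr fun y => ?_
  rw [← ENNReal.ofReal_mul (by positivity), ← smul_sub, ← mul_assoc, gaussKernel_smul hr]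

theorem heat_mono_ae {t : ℝ} (ht : 0 < t) {f g : EuclideanSpace ℝ (Fin N) → ℝ}
    (h : ∀ᵐ y, f y ≤ g y) (x : EuclideanSpace ℝ (Fin N)) : heat t f x ≤ heat t g x :=
  lintegral_mono_ae (h.mono fun _ hy => ENNReal.ofReal_le_ofReal
    (mul_le_mul_of_nonneg_left hy (gaussKernel_nonneg ht _)))

theorem heat_const_mul {t c : ℝ} (hc : 0 ≤ c) (f : EuclideanSpace ℝ (Fin N) → ℝ)
    (x : EuclideanSpace ℝ (Fin N)) :
    heat t (fun y => c * f y) x = ENNReal.ofReal c * heat t f x := by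
  unfold heat
  rw [← lintegral_const_mul' _ _ ENNReal.ofReal_ne_top]
  refine lintegral_congr fun y => ?_
  rw [← ENNReal.ofReal_mul hc]
  congr 1; ring

/-- The profile `ω(x) |x|^{-γ}`, set to zero in the ball of radius `ε`. -/
noncomputable def truncatedProfile (ω : EuclideanSpace ℝ (Fin N) → ℝ) (γ ε : ℝ) :
    EuclideanSpace ℝ (Fin N) → ℝ :=
  Set.indicator {x | ε ≤ ‖x‖} fun x => ω x * ‖x‖ ^ (-γ)

/-- Where `‖y‖ ≥ ε ≥ R / r`, the point `r • y` lies in the region of the lower bound and homogeneity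
extracts `r ^ (-γ)`; elsewhere `φ ≥ 0` suffices. -/
theorem rpow_mul_truncatedProfile_le {ω φ : EuclideanSpace ℝ (Fin N) → ℝ} {γ R ε r : ℝ}
    (hr : 0 < r) (hrε : R / r ≤ ε)
    (hω_hom : ∀ τ : ℝ, 0 < τ → ∀ᵐ x, ω (τ • x) = ω x)
    (hφ_nonneg : ∀ᵐ x, 0 ≤ φ x)
    (hφ_lower : ∀ᵐ x, R ≤ ‖x‖ → ω x * ‖x‖ ^ (-γ) ≤ φ x) :
    ∀ᵐ y, r ^ (-γ) * truncatedProfile ω γ ε y ≤ φ (r • y) := by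
  filter_upwards [hω_hom r hr, ae_comp_smul hr.ne' hφ_nonneg, ae_comp_smul hr.ne' hφ_lower]
    with y h1 h2 h3
  by_cases hy : ε ≤ ‖y‖
  · rw [truncatedProfile, Set.indicator_of_mem (show y ∈ {x | ε ≤ ‖x‖} from hy)]
    rw [norm_smul, Real.norm_of_nonneg hr.le, h1,
      Real.mul_rpow hr.le (norm_nonneg _)] at h3
    calc _ = ω y * (r ^ (-γ) * ‖y‖ ^ (-γ)) := by ring
      _ ≤ _ := h3 (by rw [mul_comm]; exact (div_le_iff₀ hr).1 (hrε.trans hy))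
  · rw [truncatedProfile, Set.indicator_of_notMem (show y ∉ {x | ε ≤ ‖x‖} from hy), mul_zero]
    exact h2

/-- Evaluating the necessary condition at `√t • x` reduces it to time `1`; the power of `t` collects
`t^{1/α}` from the blow-up bound and `(√t)^{-γ}` from homogeneity. -/
theorem ofReal_mul_heatSupNorm_truncatedProfile_le_one {α γ R ε l t : ℝ} (hα : 0 < α)
    (hl : 0 < l) (ht : 0 < t) (htε : R / √t ≤ ε)
    {ω φ : EuclideanSpace ℝ (Fin N) → ℝ}
    (hω_hom : ∀ τ : ℝ, 0 < τ → ∀ᵐ x, ω (τ • x) = ω x)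
    (hφ_nonneg : ∀ᵐ x, 0 ≤ φ x)
    (hφ_lower : ∀ᵐ x, R ≤ ‖x‖ → ω x * ‖x‖ ^ (-γ) ≤ φ x)
    (h : ∀ᵐ x, ENNReal.ofReal (α * t) * heat t (fun x => l * φ x) x ^ α ≤ 1) :
    ENNReal.ofReal (l * t ^ (1 / α - γ / 2)) *
      (ENNReal.ofReal (α ^ (1 / α)) * heatSupNorm 1 (truncatedProfile ω γ ε)) ≤ 1 := by
  have hr : 0 < √t := Real.sqrt_pos.2 ht
  set c : ℝ≥0∞ := ENNReal.ofReal (l * t ^ (1 / α - γ / 2)) * ENNReal.ofReal (α ^ (1 / α)) with hc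
  have hc0 : c ≠ 0 := by
    rw [hc, ← ENNReal.ofReal_mul (by positivity)]
    exact (ENNReal.ofReal_pos.2 (by positivity)).ne'
  have hctop : c ≠ ∞ := ENNReal.mul_ne_top ENNReal.ofReal_ne_top ENNReal.ofReal_ne_top
  have hpt : ∀ᵐ x, heat 1 (truncatedProfile ω γ ε) x ≤ c⁻¹ := by
    filter_upwards [ae_comp_smul hr.ne' h] with x hx
    have h1 : ENNReal.ofReal (l * √t ^ (-γ)) * heat 1 (truncatedProfile ω γ ε) x ≤
        heat t (fun x => l * φ x) (√t • x) := by
      have h2 := heat_sq_smul hr (fun x => l * φ x) x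
      rw [Real.sq_sqrt ht.le] at h2
      rw [h2, ← heat_const_mul (by positivity)]
      refine heat_mono_ae one_pos ?_ x
      filter_upwards [rpow_mul_truncatedProfile_le hr htε hω_hom hφ_nonneg hφ_lower] with y hy
      rw [mul_assoc]
      exact mul_le_mul_of_nonneg_left hy hl.le
    have h3 : (ENNReal.ofReal (α * t) *
        (ENNReal.ofReal (l * √t ^ (-γ)) * heat 1 (truncatedProfile ω γ ε) x) ^ α) ^ (1 / α)
          ≤ 1 :=
      ENNReal.rpow_le_one ((mul_le_mul_right (ENNReal.rpow_le_rpow h1 hα.le) _).trans hx)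
        (by positivity)
    rw [ENNReal.mul_rpow_of_nonneg _ _ (by positivity), ← ENNReal.rpow_mul,
      mul_one_div_cancel hα.ne', ENNReal.rpow_one, ENNReal.ofReal_rpow_of_pos (by positivity),
      ← mul_assoc, ← ENNReal.ofReal_mul (by positivity)] at h3
    rw [← one_div, ENNReal.le_div_iff_mul_le (Or.inl hc0) (Or.inl hctop), mul_comm]
    convert h3 using 2
    rw [hc, ← ENNReal.ofReal_mul (by positivity), Real.mul_rpow hα.le ht.le, Real.sqrt_eq_rpow,
      ← Real.rpow_mul ht.le, sub_eq_add_neg, Real.rpow_add ht]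
    congr 1
    rw [show 1 / 2 * -γ = -(γ / 2) by ring]
    ring
  rw [← mul_assoc]
  calc c * heatSupNorm 1 (truncatedProfile ω γ ε) ≤ c * c⁻¹ := by
        gcongr
        exact essSup_le_of_ae_le _ hpt
    _ ≤ 1 := ENNReal.mul_inv_le_one c

/-- A threshold for `T_max`, from any truncation radius. -/
theorem ofReal_mul_Tmax_le {α γ R ε l : ℝ} (hα : 0 < α) (hγα : γ < 2 / α) (hl : 0 < l)
    (hε : 0 < ε)
    {ω φ : EuclideanSpace ℝ (Fin N) → ℝ}
    (hω_hom : ∀ τ : ℝ, 0 < τ → ∀ᵐ x, ω (τ • x) = ω x)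
    (hφ_meas : AEMeasurable φ)
    (hφ_nonneg : ∀ᵐ x, 0 ≤ φ x)
    (hφ_lower : ∀ᵐ x, R ≤ ‖x‖ → ω x * ‖x‖ ^ (-γ) ≤ φ x) :
    ENNReal.ofReal (l ^ (1 / α - γ / 2)⁻¹) * Tmax α (fun x => l * φ x) ≤
      max (ENNReal.ofReal (l ^ (1 / α - γ / 2)⁻¹ * (R / ε) ^ 2))
        ((ENNReal.ofReal (α ^ (1 / α)) *
          heatSupNorm 1 (truncatedProfile ω γ ε))⁻¹ ^ (1 / α - γ / 2)⁻¹) := by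
  have hκ : 0 < 1 / α - γ / 2 := by
    have : 2 / α = 2 * (1 / α) := by ring
    linarith
  set κ := 1 / α - γ / 2 with hκdef
  set D := (ENNReal.ofReal (α ^ (1 / α)) * heatSupNorm 1 (truncatedProfile ω γ ε))⁻¹ with hD
  set c := ENNReal.ofReal (l ^ κ⁻¹) with hc
  have hc0 : c ≠ 0 := (ENNReal.ofReal_pos.2 (by positivity)).ne'
  have hctop : c ≠ ∞ := ENNReal.ofReal_ne_top
  rw [mul_comm, ← ENNReal.le_div_iff_mul_le (Or.inl hc0) (Or.inl hctop)]
  refine sSup_le fun T hT => ?_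
  obtain ⟨u, hu⟩ := hT
  by_contra! hlt
  set B := max (ENNReal.ofReal (l ^ κ⁻¹ * (R / ε) ^ 2)) (D ^ κ⁻¹) / c with hB
  obtain ⟨b, hb0, hBb, hbT⟩ := ENNReal.lt_iff_exists_real_btwn.1 hlt
  have hBtop : B ≠ ∞ := hlt.ne_top
  have hBb' : B.toReal < b := by
    rwa [← ENNReal.ofReal_lt_ofReal_iff_of_nonneg ENNReal.toReal_nonneg,
      ENNReal.ofReal_toReal hBtop]
  -- The necessary condition holds only for almost every time, but such times are dense, so one lies
  -- strictly between the bound and `T`.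
  obtain ⟨t, ht, hBt, htb⟩ := (Measure.dense_of_ae
    (hu.ofReal_mul_heat_rpow_le_one hα (hφ_meas.const_mul l))).exists_between hBb'
  have ht0 : 0 < t := ENNReal.toReal_nonneg.trans_lt hBt
  have hBt' : B < ENNReal.ofReal t := (ENNReal.lt_ofReal_iff_toReal_lt hBtop).2 hBt
  have hx := ht ht0 ((ENNReal.ofReal_le_ofReal htb.le).trans_lt hbT)
  have hlt' : max (ENNReal.ofReal (l ^ κ⁻¹ * (R / ε) ^ 2)) (D ^ κ⁻¹) <
      ENNReal.ofReal (l ^ κ⁻¹ * t) := by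
    rw [mul_comm _ t, ENNReal.ofReal_mul ht0.le]
    exact (ENNReal.div_lt_iff (Or.inl hc0) (Or.inl hctop)).1 hBt'
  obtain ⟨h1, h2⟩ := max_lt_iff.1 hlt'
  have h3 : (R / ε) ^ 2 < t := by
    have := (ENNReal.ofReal_lt_ofReal_iff (by positivity)).1 h1
    exact lt_of_mul_lt_mul_left this (by positivity)
  have htε : R / √t ≤ ε := by
    rw [div_le_iff₀ (Real.sqrt_pos.2 ht0), mul_comm, ← div_le_iff₀ hε]
    exact Real.le_sqrt_of_sq_le h3.le
  have h4 := ofReal_mul_heatSupNorm_truncatedProfile_le_one hα hl ht0 htε hω_hom hφ_nonneg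
    hφ_lower hx
  rw [← hκdef] at h4
  have h5 : ENNReal.ofReal (l * t ^ κ) ≤ D := ENNReal.le_inv_iff_mul_le.2 h4
  have h6 := ENNReal.rpow_le_rpow h5 (inv_pos.2 hκ).le
  rw [ENNReal.ofReal_rpow_of_pos (by positivity), Real.mul_rpow hl.le (by positivity),
    Real.rpow_rpow_inv ht0.le hκ.ne'] at h6
  exact absurd h6 (not_le.2 h2)

/-! ### Removing the truncation. -/

/-- Monotone convergence: the truncated profiles increase to the full one off the origin. -/
theorem heatSupNorm_le_iSup_truncatedProfile (hN : 1 ≤ N) {γ : ℝ}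
    {ω : EuclideanSpace ℝ (Fin N) → ℝ} (hω : AEMeasurable ω) (hω_nonneg : ∀ᵐ x, 0 ≤ ω x) :
    heatSupNorm 1 (fun x => ω x * ‖x‖ ^ (-γ)) ≤
      ⨆ n : ℕ, heatSupNorm 1 (truncatedProfile ω γ (1 / ((n : ℝ) + 1))) := by
  -- In positive dimension the origin is a null set.
  have : Nonempty (Fin N) := ⟨⟨0, hN⟩⟩
  set f : EuclideanSpace ℝ (Fin N) → ℝ := fun x => ω x * ‖x‖ ^ (-γ) with hf
  set ψ : ℕ → EuclideanSpace ℝ (Fin N) → ℝ :=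
    fun n => truncatedProfile ω γ (1 / ((n : ℝ) + 1)) with hψ
  have hψm : ∀ n, AEMeasurable (ψ n) := fun n =>
    (hω.mul ((measurable_norm.pow_const (-γ)).aemeasurable)).indicator
      (measurableSet_le measurable_const measurable_norm)
  have hmono : ∀ᵐ y, Monotone fun n => ψ n y := by
    filter_upwards [hω_nonneg] with y hy n m hnm
    exact Set.indicator_le_indicator_apply_of_subset
      (fun x (hx : _ ≤ ‖x‖) => (Nat.one_div_le_one_div hnm).trans hx) (by positivity)
  have hlim : ∀ᵐ y, ∃ n, ψ n y = f y := by
    filter_upwards [Measure.ae_ne volume (0 : EuclideanSpace ℝ (Fin N))] with y hy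
    obtain ⟨n, hn⟩ := exists_nat_one_div_lt (norm_pos_iff.2 hy)
    exact ⟨n, Set.indicator_of_mem (show y ∈ {x | 1 / ((n : ℝ) + 1) ≤ ‖x‖} from hn.le) _⟩
  have hpt : ∀ x, heat 1 f x ≤ ⨆ n, heat 1 (ψ n) x := by
    intro x
    unfold heat
    rw [← lintegral_iSup']
    · refine lintegral_mono_ae ?_
      filter_upwards [hlim] with y hy
      obtain ⟨n, hn⟩ := hy
      rw [← hn]
      exact le_iSup (fun n => ENNReal.ofReal (gaussKernel 1 (x - y) * ψ n y)) n
    · intro n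
      have h1 : Measurable fun y : EuclideanSpace ℝ (Fin N) => gaussKernel 1 (x - y) :=
        measurable_gaussKernel.comp
          (measurable_const.prodMk (measurable_const.sub measurable_id))
      exact (h1.aemeasurable.mul (hψm n)).ennreal_ofReal
    · filter_upwards [hmono] with y hy n m hnm
      exact ENNReal.ofReal_le_ofReal
        (mul_le_mul_of_nonneg_left (hy hnm) (gaussKernel_nonneg one_pos _))
  refine essSup_le_of_ae_le _ ?_
  have hae : ∀ᵐ x, ∀ n, heat 1 (ψ n) x ≤ heatSupNorm 1 (ψ n) :=
    ae_all_iff.2 fun n => ENNReal.ae_le_essSup _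
  filter_upwards [hae] with x hx
  exact (hpt x).trans (iSup_mono hx)

/-- The kernel is strictly positive, so vanishing at a single point already forces `ω = 0` almost
everywhere. -/
theorem heatSupNorm_ne_zero (hN : 1 ≤ N) {γ : ℝ}
    {ω : EuclideanSpace ℝ (Fin N) → ℝ} (hω : AEMeasurable ω) (hω_nonneg : ∀ᵐ x, 0 ≤ ω x)
    (hω_ne : ¬ (ω =ᵐ[volume] 0)) :
    heatSupNorm 1 (fun x => ω x * ‖x‖ ^ (-γ)) ≠ 0 := by
  have : Nonempty (Fin N) := ⟨⟨0, hN⟩⟩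
  intro h0
  obtain ⟨x, hx⟩ := (ENNReal.essSup_eq_zero_iff.1 h0).exists
  have h1 : Measurable fun y : EuclideanSpace ℝ (Fin N) => gaussKernel 1 (x - y) :=
    measurable_gaussKernel.comp (measurable_const.prodMk (measurable_const.sub measurable_id))
  have h2 : AEMeasurable fun y : EuclideanSpace ℝ (Fin N) =>
      ENNReal.ofReal (gaussKernel 1 (x - y) * (ω y * ‖y‖ ^ (-γ))) :=
    (h1.aemeasurable.mul
      (hω.mul (measurable_norm.pow_const (-γ)).aemeasurable)).ennreal_ofReal
  have h3 := (lintegral_eq_zero_iff' h2).1 hx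
  refine hω_ne ?_
  filter_upwards [h3, hω_nonneg, Measure.ae_ne volume (0 : EuclideanSpace ℝ (Fin N))]
    with y hy hy0 hne
  have h4 := ENNReal.ofReal_eq_zero.1 hy
  have h5 : 0 < gaussKernel 1 (x - y) := gaussKernel_pos one_pos _
  have h6 : 0 < ‖y‖ ^ (-γ) := Real.rpow_pos_of_pos (norm_pos_iff.2 hne) _
  by_contra hcon
  have h7 : 0 < ω y := lt_of_le_of_ne hy0 (Ne.symm hcon)
  exact absurd h4 (not_le.2 (by positivity))

end NLH

/-! ### Finiteness and the limit `λ → 0`. -/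

theorem theorem1p7 (N : ℕ) (hN : 1 ≤ N) (α γ : ℝ) (hα : 0 < α)
    (hγ : 0 < γ) (hγN : γ < N) (hγα : γ < 2 / α)
    (ω : EuclideanSpace ℝ (Fin N) → ℝ)
    (hω_bdd : MemLp ω ∞ volume)
    (hω_hom : ∀ τ : ℝ, 0 < τ → ∀ᵐ x, ω (τ • x) = ω x)
    (hω_nonneg : ∀ᵐ x, 0 ≤ ω x)
    (hω_ne : ¬ (ω =ᵐ[volume] 0))
    (φ : EuclideanSpace ℝ (Fin N) → ℝ)
    (hφ_int : LocallyIntegrable φ volume)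
    (hφ_nonneg : ∀ᵐ x, 0 ≤ φ x)
    (R : ℝ) (hR : 0 < R)
    (hφ_lower : ∀ᵐ x, R ≤ ‖x‖ → ω x * ‖x‖ ^ (-γ) ≤ φ x) :
    (∀ l : ℝ, 0 < l → NLH.Tmax α (fun x => l * φ x) < ∞) ∧
    limsup (fun l : ℝ => ENNReal.ofReal (l ^ (1 / α - γ / 2)⁻¹) * NLH.Tmax α (fun x => l * φ x))
        (𝓝[>] 0)
      ≤ 1 / (ENNReal.ofReal (α ^ (1 / α)) *
          NLH.heatSupNorm 1 (fun x => ω x * ‖x‖ ^ (-γ))) ^ (1 / α - γ / 2)⁻¹ := by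
  have hωm : AEMeasurable ω := hω_bdd.1.aemeasurable
  have hφm : AEMeasurable φ := hφ_int.aestronglyMeasurable.aemeasurable
  have hκ : 0 < 1 / α - γ / 2 := by
    have : 2 / α = 2 * (1 / α) := by ring
    linarith
  have hκi := inv_pos.2 hκ
  have hbound := fun (n : ℕ) (l : ℝ) (hl : 0 < l) =>
    NLH.ofReal_mul_Tmax_le (ε := 1 / ((n : ℝ) + 1)) hα hγα hl (by positivity) hω_hom hφm
      hφ_nonneg hφ_lower
  have hsup := NLH.heatSupNorm_le_iSup_truncatedProfile (γ := γ) hN hωm hω_nonneg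
  have ha : ENNReal.ofReal (α ^ (1 / α)) ≠ 0 := (ENNReal.ofReal_pos.2 (by positivity)).ne'
  set κ := 1 / α - γ / 2
  constructor
  · intro l hl
    -- Some truncation retains a nonzero norm, which makes the threshold finite.
    obtain ⟨n, hn⟩ : ∃ n : ℕ,
        NLH.heatSupNorm 1 (NLH.truncatedProfile ω γ (1 / ((n : ℝ) + 1))) ≠ 0 := by
      by_contra! h
      simp only [h, iSup_const, nonpos_iff_eq_zero] at hsup
      exact NLH.heatSupNorm_ne_zero hN hωm hω_nonneg hω_ne hsup
    have h1 := (hbound n l hl).trans_lt (max_lt ENNReal.ofReal_lt_top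
      (ENNReal.rpow_lt_top_of_nonneg hκi.le (ENNReal.inv_ne_top.2 (mul_ne_zero ha hn))))
    by_contra h2
    rw [not_lt, top_le_iff] at h2
    rw [h2, ENNReal.mul_top (ENNReal.ofReal_pos.2 (by positivity)).ne'] at h1
    exact lt_irrefl _ h1
  · set L := limsup (fun l : ℝ => ENNReal.ofReal (l ^ κ⁻¹) * NLH.Tmax α (fun x => l * φ x))
      (𝓝[>] 0)
    have hL : ∀ n : ℕ, L ≤ (ENNReal.ofReal (α ^ (1 / α)) *
        NLH.heatSupNorm 1 (NLH.truncatedProfile ω γ (1 / ((n : ℝ) + 1))))⁻¹ ^ κ⁻¹ := by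
      intro n
      have hlim : Tendsto (fun l : ℝ => ENNReal.ofReal (l ^ κ⁻¹ * (R / (1 / ((n : ℝ) + 1))) ^ 2))
          (𝓝[>] 0) (𝓝 0) := by
        have hc : Continuous fun l : ℝ =>
            ENNReal.ofReal (l ^ κ⁻¹ * (R / (1 / ((n : ℝ) + 1))) ^ 2) :=
          ENNReal.continuous_ofReal.comp
            ((Real.continuous_rpow_const hκi.le).mul continuous_const)
        have := (hc.tendsto 0).mono_left (nhdsWithin_le_nhds (s := Set.Ioi 0))
        simpa [Real.zero_rpow hκi.ne'] using this
      have hmax := hlim.max (tendsto_const_nhds (x := (ENNReal.ofReal (α ^ (1 / α)) *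
        NLH.heatSupNorm 1 (NLH.truncatedProfile ω γ (1 / ((n : ℝ) + 1))))⁻¹ ^ κ⁻¹))
      rw [max_eq_right zero_le] at hmax
      rw [← hmax.limsup_eq]
      refine limsup_le_limsup ?_
      filter_upwards [self_mem_nhdsWithin] with l hl
      exact hbound n l hl
    -- Inverting isolates the norm as `α^{1/α} ‖·‖ ≤ (L^κ)⁻¹`, so the supremum over truncations can
    -- be bounded term by term.
    rw [one_div (_ ^ κ⁻¹), ← ENNReal.inv_rpow, ENNReal.le_rpow_inv_iff hκ, ENNReal.le_inv_iff_le_inv]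
    refine (mul_le_mul_right hsup _).trans ?_
    rw [ENNReal.mul_iSup]
    refine iSup_le fun n => ?_
    rw [← ENNReal.le_inv_iff_le_inv, ← ENNReal.le_rpow_inv_iff hκ]
    exact hL n
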